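/- For $\theta\in\mathbb R$ let $|\theta\rangle=\frac{|\downarrow\rangle+e^{i\theta}|\uparrow\rangle}{\sqrt2}\in\mathbb C^2$ with $|\downarrow\rangle=|0\rangle$, $|\uparrow\rangle=|1\rangle$. A feed-forward (dissipative) quantum neural network (QNN) consists of layers of qubits $0,1,\dots,L+1$ with $L\ge 0$; its architecture fixes the number of qubits in each layer and, for every qubit $j$ of every layer $l\ge1$, a set of qubits of layer $l-1$ connected to it. Its parameters are arbitrary unitaries $U^l_j$, each acting on qubit $j$ of layer $l$ and the qubits of layer $l-1$ connected to it. With $U^l=U^l_{m_l}\cdots U^l_1$ ($m_l$ the number of qubits of layer $l$), the network implements the channel $\mathcal N_{\mathcal U}=\mathcal E^{L+1}\circ\cdots\circ\mathcal E^1$, where $\mathcal E^l(X)=\operatorname{tr}_{l-1}\big(U^l(X\otimes|0\dots0\rangle\langle0\dots0|)U^{l\dagger}\big)$. Only networks with one input qubit and one output qubit are considered. Given $v\in\mathbb R$, $T\ge1$ and phases $\phi_1,\dots,\phi_T$, the network is trained on the sequence $\big(|\phi_t\rangle,|\phi_t-v(t-1)\rangle\big)_{t=1}^T$, and its optimal cost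 is the optimal average fidelity $$C_{QNN}=\sup_{\mathcal U}\frac1T\sum_{t=1}^T\langle\phi_t-v(t-1)|\,\mathcal N_{\mathcal U}\big(|\phi_t\rangle\langle\phi_t|\big)\,|\phi_t-v(t-1)\rangle .$$ Let $C_{\mathrm{CPTP}}$ be the same supremum with $\mathcal N_{\mathcal U}$ replaced by an arbitrary single-qubit quantum channel (completely positive trace-preserving map). There is a constant $c>0$, independent of $T$, $\eta$, $v$ and the architecture, such that the following holds for all $v\in\mathbb R$ with $e^{iv}\neq1$ and all $T\ge1$. Let $\phi_1,\dots,\phi_T$ be independent random phases, each uniformly distributed on $[0,2\pi)$. Then for every $\eta>0$, with probability at least $1-\eta$, both $C_{\mathrm{CPTP}}$ and the optimal cost $C_{QNN}$ of every architecture satisfy $$C\le\frac12+\frac{c}{\sqrt\eta\,|1-e^{iv}|}\,\frac1{\sqrt[3]{T}} .$$ Moreover, $C_{\mathrm{CPTP}}\ge\frac12$ and $C_{QNN}\ge\frac12$ for every architecture, with certainty (for every realisation of the phases). -/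

import Mathlib

open scoped Kronecker ComplexOrder

namespace DriftQNN

/-! ### Qubit registers, partial trace, quantum channels -/

/-- Labels of the computational basis of `m` qubits; `0` is `|0⟩ = |↓⟩`, `1` is `|1⟩ = |↑⟩`. -/
abbrev Bits (m : ℕ) : Type := Fin m → Fin 2

/-- Operators on the Hilbert space of `m` qubits. -/
abbrev Op (m : ℕ) : Type := Matrix (Bits m) (Bits m) ℂ

/-- The projector `|0…0⟩⟨0…0|` on `n` qubits. -/
def zeroState (n : ℕ) : Op n := Matrix.single 0 0 1

/-- Partial trace over the first tensor factor. -/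
def partialTraceFst {α β : Type*} [Fintype α] (M : Matrix (α × β) (α × β) ℂ) : Matrix β β ℂ :=
  Matrix.of fun y y' => ∑ x, M (x, y) (x, y')

/-- The map `id_k ⊗ Φ` on `M_k(ℂ) ⊗ B(H)`: `Φ` is applied to each block of a `k × k` block matrix. -/
def amplify {m n : ℕ} (Φ : Op m →ₗ[ℂ] Op n) (k : ℕ)
    (M : Matrix (Fin k × Bits m) (Fin k × Bits m) ℂ) :
    Matrix (Fin k × Bits n) (Fin k × Bits n) ℂ :=
  Matrix.of fun p q => Φ (Matrix.of fun a b => M (p.1, a) (q.1, b)) p.2 q.2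

/-- A quantum channel: a completely positive, trace-preserving linear map. -/
structure IsCPTP {m n : ℕ} (Φ : Op m →ₗ[ℂ] Op n) : Prop where
  completelyPositive : ∀ (k : ℕ) (M : Matrix (Fin k × Bits m) (Fin k × Bits m) ℂ),
    M.PosSemidef → (amplify Φ k M).PosSemidef
  trace_preserving : ∀ X : Op m, (Φ X).trace = X.trace

/-! ### Feed-forward (dissipative) quantum neural networks -/

/-- The unitaries of one layer with `n` perceptrons, fed by a layer of `m` qubits; the `j`-th
perceptron is connected to the qubits in `conn j` of the previous layer, and its unitary acts on
these qubits and on its own qubit. -/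
abbrev LayerParams {m n : ℕ} (conn : Fin n → Finset (Fin m)) : Type :=
  (j : Fin n) → Matrix.unitaryGroup ((conn j → Fin 2) × Fin 2) ℂ

/-- An operator `u` on the qubits in `S` of the previous layer and on the `j`-th qubit of the
current layer, regarded as an operator on all qubits of both layers (that is, tensored with the
identity on all other qubits). -/
def extendPerceptron {m n : ℕ} (S : Finset (Fin m)) (j : Fin n)
    (u : Matrix ((S → Fin 2) × Fin 2) ((S → Fin 2) × Fin 2) ℂ) :
    Matrix (Bits m × Bits n) (Bits m × Bits n) ℂ :=
  Matrix.of fun p q =>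
    if (∀ i, i ∉ S → p.1 i = q.1 i) ∧ (∀ i, i ≠ j → p.2 i = q.2 i) then
      u (fun i => p.1 i, p.2 j) (fun i => q.1 i, q.2 j)
    else 0

/-- The layer unitary `U_n ⋯ U_2 U_1`. -/
noncomputable def layerUnitary {m n : ℕ} {conn : Fin n → Finset (Fin m)} (U : LayerParams conn) :
    Matrix (Bits m × Bits n) (Bits m × Bits n) ℂ :=
  (List.ofFn fun j => extendPerceptron (conn j) j (U j : Matrix _ _ ℂ)).reverse.prod

/-- The layer-to-layer map `X ↦ tr_{prev} (U (X ⊗ |0…0⟩⟨0…0|) U†)`. -/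
noncomputable def layerChannel {m n : ℕ} {conn : Fin n → Finset (Fin m)} (U : LayerParams conn)
    (X : Op m) : Op n :=
  partialTraceFst (layerUnitary U * (X ⊗ₖ zeroState n) * (layerUnitary U).conjTranspose)

/-- Architectures of feed-forward QNNs with `m` input qubits and `n` output qubits: at least one
layer of perceptrons, with arbitrary widths of the hidden layers and arbitrary connections between
consecutive layers. -/
inductive Arch (m : ℕ) : ℕ → Type
  | single {n : ℕ} (conn : Fin n → Finset (Fin m)) : Arch m n
  | snoc {k n : ℕ} (A : Arch m k) (conn : Fin n → Finset (Fin k)) : Arch m n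

/-- The trainable parameters of an architecture: one unitary for each perceptron. -/
def Arch.Params {m : ℕ} : {n : ℕ} → Arch m n → Type
  | _, .single conn => LayerParams conn
  | _, .snoc A conn => A.Params × LayerParams conn

/-- The input-output map of the network, the composition of its layer-to-layer channels. -/
noncomputable def Arch.channel {m : ℕ} : {n : ℕ} → (A : Arch m n) → A.Params → Op m → Op n
  | _, .single _, U, X => layerChannel (show LayerParams _ from U) X
  | _, .snoc A _, U, X => layerChannel U.2 (A.channel U.1 X)

/-! ### The drift task -/

/-- The interferometric qubit state `|θ⟩ = (|↓⟩ + e^{iθ} |↑⟩) / √2`. -/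
noncomputable def phaseKet (θ : ℝ) : Bits 1 → ℂ :=
  fun b => (if b 0 = 0 then 1 else Complex.exp (Complex.I * θ)) / (Real.sqrt 2 : ℂ)

/-- The density matrix `|θ⟩⟨θ|`. -/
noncomputable def phaseState (θ : ℝ) : Op 1 :=
  Matrix.vecMulVec (phaseKet θ) (star (phaseKet θ))

/-- The fidelity `⟨θ|ρ|θ⟩`. -/
noncomputable def fidelity (θ : ℝ) (ρ : Op 1) : ℝ :=
  (dotProduct (star (phaseKet θ)) (ρ.mulVec (phaseKet θ))).re

/-- The cost of the map `E` on the sequence `(|φ_t⟩, |φ_t - v (t - 1)⟩)`, `t = 1, …, T`: the average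
fidelity of its outputs with the labels. Here `t : Fin T` counts from `0`. -/
noncomputable def driftCost {T : ℕ} (v : ℝ) (φ : Fin T → ℝ) (E : Op 1 → Op 1) : ℝ :=
  (1 / (T : ℝ)) * ∑ t : Fin T, fidelity (φ t - v * (t : ℕ)) (E (phaseState (φ t)))

/-- The optimal cost `C_QNN` of the architecture `A` on the drift sequence: the supremum over all
choices of the perceptron unitaries. -/
noncomputable def qnnOptimalCost {T : ℕ} (v : ℝ) (φ : Fin T → ℝ) (A : Arch 1 1) : ℝ :=
  ⨆ U : A.Params, driftCost v φ (A.channel U)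

/-- The optimal cost on the drift sequence over all single-qubit quantum channels. -/
noncomputable def channelOptimalCost {T : ℕ} (v : ℝ) (φ : Fin T → ℝ) : ℝ :=
  ⨆ E : {E : Op 1 →ₗ[ℂ] Op 1 // IsCPTP E}, driftCost v φ E.1

end DriftQNN

namespace DriftQNN

/-! ### Kraus maps and the channels of a network -/

/-! The fidelity of an output `ρ` with `|θ⟩` is `1/2 + Re (e^{iθ} ρ₀₁)`, and `ρ₀₁` is linear in the
entries `1`, `e^{±iφ}` of the input (up to a factor 1/2). So the cost of any channel is 1/2 plus the
real part of a combination of three exponential sums `phaseSum v k`, `k = 0, 1, 2`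
(`IsCPTP.driftCost_eq`), with coefficients bounded by complete positivity and trace preservation
(`IsCPTP.norm_apply_single_le`). The resulting bound depends on the phases alone, so one event
serves all channels at once and no union bound or net is needed.

The sum `k = 0` is deterministic and geometric, of size `O(1 / (T |1 - e^{iv}|))`. For `k = 1, 2`
the terms are independent, centred and unimodular, so the second moment is exactly `1/T`, and
Markov's inequality gives `O(1 / √(ηT))`. The rate obtained is thus `T^{-1/2}`, weakened to
`T^{-1/3}` only in `upper_bound_arith`.

Every network is a channel (`Arch.exists_isCPTP`), so its optimum is at most that over channels. The
lower bounds come from the network with all unitaries trivial: it always outputs `|0⟩`, whose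
fidelity with every `|θ⟩` is 1/2. -/

/-- The map `X ↦ ∑ x, K x * X * (K x)†` with Kraus operators `K x`. -/
def krausMap {m n : ℕ} {ι : Type*} [Fintype ι] (K : ι → Matrix (Bits n) (Bits m) ℂ) :
    Op m →ₗ[ℂ] Op n where
  toFun X := ∑ x, K x * X * (K x).conjTranspose
  map_add' X Y := by simp [Matrix.mul_add, Matrix.add_mul, Finset.sum_add_distrib]
  map_smul' c X := by simp [Finset.smul_sum]

theorem amplify_krausMap {m n : ℕ} {ι : Type*} [Fintype ι] (K : ι → Matrix (Bits n) (Bits m) ℂ)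
    (k : ℕ) (M : Matrix (Fin k × Bits m) (Fin k × Bits m) ℂ) :
    amplify (krausMap K) k M =
      ∑ x, ((1 : Matrix (Fin k) (Fin k) ℂ) ⊗ₖ K x) * M *
        ((1 : Matrix (Fin k) (Fin k) ℂ) ⊗ₖ K x).conjTranspose := by
  ext ⟨i, a⟩ ⟨j, b⟩
  simp [amplify, krausMap, Matrix.sum_apply, Matrix.mul_apply, Fintype.sum_prod_type,
    Matrix.one_apply, apply_ite]

theorem isCPTP_krausMap {m n : ℕ} {ι : Type*} [Fintype ι] (K : ι → Matrix (Bits n) (Bits m) ℂ)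
    (hK : ∑ x, (K x).conjTranspose * K x = 1) : IsCPTP (krausMap K) where
  completelyPositive k M hM := by
    rw [amplify_krausMap]
    exact Matrix.posSemidef_sum _ fun x _ => hM.mul_mul_conjTranspose_same _
  trace_preserving X := by
    change (∑ x, K x * X * (K x).conjTranspose).trace = X.trace
    simp_rw [Matrix.trace_sum, Matrix.trace_mul_cycle (K _) X]
    rw [← Matrix.trace_sum, ← Finset.sum_mul, hK, one_mul]

theorem IsCPTP.comp {l m n : ℕ} {Ψ : Op m →ₗ[ℂ] Op n} {Φ : Op l →ₗ[ℂ] Op m}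
    (hΨ : IsCPTP Ψ) (hΦ : IsCPTP Φ) : IsCPTP (Ψ ∘ₗ Φ) where
  completelyPositive k M hM := hΨ.completelyPositive k _ (hΦ.completelyPositive k M hM)
  trace_preserving X := (hΨ.trace_preserving _).trans (hΦ.trace_preserving X)

/-- Splitting the qubits of two consecutive layers into those a perceptron acts on and the rest. -/
def perceptronSplit {m n : ℕ} (S : Finset (Fin m)) (j : Fin n) :
    Bits m × Bits n ≃
      ((S → Fin 2) × Fin 2) × (({i // i ∉ S} → Fin 2) × ({i // i ≠ j} → Fin 2)) :=
  ((Equiv.piEquivPiSubtypeProd (· ∈ S) fun _ => Fin 2).prodCongr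
    (Equiv.funSplitAt j (Fin 2))).trans (Equiv.prodProdProdComm _ _ _ _)

/-- Exhibiting the extension as `u ⊗ 1` up to reindexing lets unitarity follow from the Kronecker
product rules. -/
theorem extendPerceptron_eq_submatrix {m n : ℕ} (S : Finset (Fin m)) (j : Fin n)
    (u : Matrix ((S → Fin 2) × Fin 2) ((S → Fin 2) × Fin 2) ℂ) :
    extendPerceptron S j u = (u ⊗ₖ (1 : Matrix (({i // i ∉ S} → Fin 2) × ({i // i ≠ j} → Fin 2))
      (({i // i ∉ S} → Fin 2) × ({i // i ≠ j} → Fin 2)) ℂ)).submatrix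
        (perceptronSplit S j) (perceptronSplit S j) := by
  ext p q
  simp [extendPerceptron, perceptronSplit, Matrix.one_apply, funext_iff, Prod.ext_iff,
    Equiv.piEquivPiSubtypeProd, Equiv.funSplitAt, Equiv.piSplitAt]

theorem extendPerceptron_one {m n : ℕ} (S : Finset (Fin m)) (j : Fin n) :
    extendPerceptron S j 1 = 1 := by
  simp [extendPerceptron_eq_submatrix]

theorem extendPerceptron_mem_unitaryGroup {m n : ℕ} (S : Finset (Fin m)) (j : Fin n)
    {u : Matrix ((S → Fin 2) × Fin 2) ((S → Fin 2) × Fin 2) ℂ}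
    (hu : u ∈ Matrix.unitaryGroup ((S → Fin 2) × Fin 2) ℂ) :
    extendPerceptron S j u ∈ Matrix.unitaryGroup (Bits m × Bits n) ℂ := by
  rw [Matrix.mem_unitaryGroup_iff, Matrix.star_eq_conjTranspose] at hu ⊢
  rw [extendPerceptron_eq_submatrix, Matrix.conjTranspose_submatrix, Matrix.submatrix_mul_equiv,
    Matrix.conjTranspose_kronecker, ← Matrix.mul_kronecker_mul, hu]
  simp

theorem layerUnitary_mem_unitaryGroup {m n : ℕ} {conn : Fin n → Finset (Fin m)}
    (U : LayerParams conn) : layerUnitary U ∈ Matrix.unitaryGroup (Bits m × Bits n) ℂ := by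
  refine Submonoid.list_prod_mem _ fun V hV => ?_
  obtain ⟨j, rfl⟩ := (List.mem_ofFn' _ _).1 (List.mem_reverse.1 hV)
  exact extendPerceptron_mem_unitaryGroup _ _ (U j).2

theorem layerUnitary_one {m n : ℕ} {conn : Fin n → Finset (Fin m)} :
    layerUnitary (fun _ => 1 : LayerParams conn) = 1 := by
  refine List.prod_eq_one fun V hV => ?_
  obtain ⟨j, rfl⟩ := (List.mem_ofFn' _ _).1 (List.mem_reverse.1 hV)
  exact extendPerceptron_one _ _

/-- The Kraus operators of a layer. -/
noncomputable def layerKraus {m n : ℕ} {conn : Fin n → Finset (Fin m)} (U : LayerParams conn)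
    (x : Bits m) : Matrix (Bits n) (Bits m) ℂ :=
  (layerUnitary U).submatrix (fun y => (x, y)) (fun a => (a, 0))

/-- With the new layer prepared in `|0…0⟩`, the layer unitary restricts to an isometry; this is the
corresponding block of `U†U = 1`. -/
theorem sum_layerKraus {m n : ℕ} {conn : Fin n → Finset (Fin m)} (U : LayerParams conn) :
    ∑ x, (layerKraus U x).conjTranspose * layerKraus U x = 1 := by
  have h := Matrix.mem_unitaryGroup_iff'.1 (layerUnitary_mem_unitaryGroup U)
  ext a b
  have h' := congrFun (congrFun h (a, 0)) (b, 0)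
  rw [Matrix.mul_apply, Fintype.sum_prod_type] at h'
  simpa [Matrix.sum_apply, Matrix.mul_apply, layerKraus, Matrix.one_apply] using h'

theorem layerChannel_eq_krausMap {m n : ℕ} {conn : Fin n → Finset (Fin m)}
    (U : LayerParams conn) (X : Op m) : layerChannel U X = krausMap (layerKraus U) X := by
  ext y y'
  simp [layerChannel, krausMap, partialTraceFst, Matrix.sum_apply, Matrix.mul_apply,
    layerKraus, Fintype.sum_prod_type, zeroState, Matrix.single_apply, ite_and]

/-- Every network implements a quantum channel. -/
theorem Arch.exists_isCPTP {m : ℕ} : ∀ {n : ℕ} (A : Arch m n) (U : A.Params),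
    ∃ E : Op m →ₗ[ℂ] Op n, IsCPTP E ∧ ⇑E = A.channel U
  | _, .single _, U => ⟨_, isCPTP_krausMap _ (sum_layerKraus (show LayerParams _ from U)),
      funext fun X => (layerChannel_eq_krausMap _ X).symm⟩
  | _, .snoc A _, U => by
    obtain ⟨E, hE, hEU⟩ := A.exists_isCPTP U.1
    exact ⟨_, (isCPTP_krausMap _ (sum_layerKraus U.2)).comp hE,
      funext fun X => by
        change _ = layerChannel U.2 (A.channel U.1 X)
        rw [layerChannel_eq_krausMap, ← hEU]; rfl⟩

theorem layerChannel_one {m n : ℕ} {conn : Fin n → Finset (Fin m)} (X : Op m) :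
    layerChannel (fun _ => 1 : LayerParams conn) X = X.trace • zeroState n := by
  ext y y'
  simp [layerChannel, layerUnitary_one, partialTraceFst, Matrix.trace, Finset.sum_mul]

/-- Every network can be trained to output `|0…0⟩` whatever its input. -/
theorem Arch.exists_channel_eq_zeroState {m : ℕ} : ∀ {n : ℕ} (A : Arch m n),
    ∃ U : A.Params, ∀ X, A.channel U X = X.trace • zeroState n
  | _, .single _ => ⟨fun _ => 1, fun X => layerChannel_one X⟩
  | _, .snoc A _ => by
    obtain ⟨U, hU⟩ := A.exists_channel_eq_zeroState
    refine ⟨(U, fun _ => 1), fun X => ?_⟩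
    obtain ⟨E, hE, hEU⟩ := A.exists_isCPTP U
    change layerChannel (fun _ => 1) (A.channel U X) = _
    rw [layerChannel_one, ← hEU, hE.trace_preserving]

/-! ### Matrix entries of channels -/

/-- Nonnegativity of a 2 × 2 principal minor, which vanishes when `i = j`. -/
theorem _root_.Matrix.PosSemidef.norm_apply_sq_le {ι : Type*} {M : Matrix ι ι ℂ}
    (hM : M.PosSemidef) (i j : ι) : ‖M i j‖ ^ 2 ≤ (M i i).re * (M j j).re := by
  have h := (hM.submatrix ![i, j]).det_nonneg
  rw [Matrix.det_fin_two] at h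
  have h2 := (Complex.le_def.1 h).1
  have hi : (M i i).im = 0 := Complex.conj_eq_iff_im.1 (hM.1.apply i i)
  have hji : M j i = star (M i j) := (hM.1.apply j i).symm
  simp only [Matrix.submatrix_apply, Matrix.cons_val_zero, Matrix.cons_val_one, hji,
    Complex.star_def, Complex.mul_conj, Complex.sub_re, Complex.mul_re, hi, Complex.ofReal_re,
    Complex.zero_re, Complex.normSq_eq_norm_sq] at h2
  linarith

theorem _root_.Matrix.PosSemidef.re_apply_self_nonneg {ι : Type*} {M : Matrix ι ι ℂ}
    (hM : M.PosSemidef) (i : ι) : 0 ≤ (M i i).re := by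
  have h := (hM.submatrix ![i]).det_nonneg
  rw [Matrix.det_unique] at h
  exact (Complex.le_def.1 h).1

theorem IsCPTP.posSemidef {m n : ℕ} {Φ : Op m →ₗ[ℂ] Op n} (hΦ : IsCPTP Φ) {X : Op m}
    (hX : X.PosSemidef) : (Φ X).PosSemidef :=
  (hΦ.completelyPositive 1 _ (hX.submatrix Prod.snd)).submatrix fun a => ((0 : Fin 1), a)

/-- A two-block version of the Choi matrix. Its diagonal blocks are outputs of basis states, with
diagonal entries in `[0, 1]` by positivity and trace preservation; the minor inequality then
controls the off-diagonal block. -/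
theorem IsCPTP.norm_apply_single_le {m n : ℕ} {Φ : Op m →ₗ[ℂ] Op n} (hΦ : IsCPTP Φ)
    (x y : Bits m) (a b : Bits n) : ‖Φ (Matrix.single x y 1) a b‖ ≤ 1 := by
  -- The unnormalised vector `|0⟩|x⟩ + |1⟩|y⟩`; block `(0, 1)` of its projector is the matrix unit
  -- at `(x, y)`. The case `x = y` is allowed.
  let w : Fin 2 × Bits m → ℂ := fun p => if p.2 = ![x, y] p.1 then 1 else 0
  have hC := hΦ.completelyPositive 2 _ (Matrix.posSemidef_vecMulVec_self_star w)
  have hblock (i j : Fin 2) (c d : Bits n) :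
      amplify Φ 2 (Matrix.vecMulVec w (star w)) (i, c) (j, d) =
        Φ (Matrix.single (![x, y] i) (![x, y] j) 1) c d := by
    have hM : (Matrix.of fun s t => Matrix.vecMulVec w (star w) (i, s) (j, t)) =
        Matrix.single (![x, y] i) (![x, y] j) 1 := by
      ext s t
      by_cases hs : s = ![x, y] i <;> by_cases ht : t = ![x, y] j <;>
        simp [w, Matrix.vecMulVec_apply, eq_comm, hs, ht]
    rw [← hM]
    rfl
  have hdiag (i : Fin 2) (c : Bits n) :
      0 ≤ (Φ (Matrix.single (![x, y] i) (![x, y] i) 1) c c).re ∧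
        (Φ (Matrix.single (![x, y] i) (![x, y] i) 1) c c).re ≤ 1 := by
    have hnn (c : Bits n) : 0 ≤ (Φ (Matrix.single (![x, y] i) (![x, y] i) 1) c c).re := by
      rw [← hblock]; exact hC.re_apply_self_nonneg _
    refine ⟨hnn c, ?_⟩
    have htr := congrArg Complex.re
      (hΦ.trace_preserving (Matrix.single (![x, y] i) (![x, y] i) 1))
    rw [Matrix.trace_single_eq_same, Matrix.trace, Complex.re_sum, Complex.one_re] at htr
    rw [← htr]
    exact Finset.single_le_sum
      (f := fun c => (Matrix.diag (Φ (Matrix.single (![x, y] i) (![x, y] i) 1)) c).re)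
      (fun c _ => hnn c) (Finset.mem_univ c)
  have h := hC.norm_apply_sq_le (0, a) (1, b)
  rw [hblock, hblock, hblock] at h
  have h1 := mul_le_one₀ (hdiag 0 a).2 (hdiag 1 b).1 (hdiag 1 b).2
  exact (sq_le_one_iff₀ (norm_nonneg _)).1 (h.trans h1)

/-! ### Single-qubit fidelities -/

theorem sum_bits_one {M : Type*} [AddCommMonoid M] (f : Bits 1 → M) :
    ∑ b, f b = f 0 + f 1 := by
  rw [← (Equiv.funUnique (Fin 1) (Fin 2)).symm.sum_comp, Fin.sum_univ_two]
  rfl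

theorem fidelity_eq {θ : ℝ} {ρ : Op 1} (hρ : ρ.IsHermitian) :
    fidelity θ ρ = ρ.trace.re / 2 + (Complex.exp (Complex.I * θ) * ρ 0 1).re := by
  have h2 : (Real.sqrt 2 : ℂ) * Real.sqrt 2 = 2 := by
    rw [← Complex.ofReal_mul, Real.mul_self_sqrt (by norm_num)]; norm_num
  have h2' : (Real.sqrt 2 : ℂ)⁻¹ * (Real.sqrt 2 : ℂ)⁻¹ = 2⁻¹ := by rw [← mul_inv, h2]
  have h10 : ρ 1 0 = star (ρ 0 1) := (hρ.apply 1 0).symm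
  have hn : star (Complex.exp (Complex.I * θ)) * Complex.exp (Complex.I * θ) = 1 := by
    rw [Complex.star_def, ← Complex.exp_conj, ← Complex.exp_add]
    simp
  have key : dotProduct (star (phaseKet θ)) (ρ.mulVec (phaseKet θ)) =
      2⁻¹ * (ρ.trace + (Complex.exp (Complex.I * θ) * ρ 0 1 +
        star (Complex.exp (Complex.I * θ) * ρ 0 1))) := by
    simp only [dotProduct, Matrix.mulVec, sum_bits_one, phaseKet, Pi.star_apply, Matrix.trace,
      Matrix.diag, h10, Pi.zero_apply, Pi.one_apply, if_true, one_ne_zero, if_false, star_mul',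
      div_eq_mul_inv, star_one, one_mul, star_inv₀]
    rw [show star (Real.sqrt 2 : ℂ) = Real.sqrt 2 from Complex.conj_ofReal _]
    linear_combination (ρ 0 0 + ρ 0 1 * Complex.exp (Complex.I * θ) +
      star (Complex.exp (Complex.I * θ)) * star (ρ 0 1) + star (Complex.exp (Complex.I * θ)) *
        Complex.exp (Complex.I * θ) * ρ 1 1) * h2' + 2⁻¹ * ρ 1 1 * hn
  rw [fidelity, key, Complex.star_def, Complex.add_conj]
  have : (2⁻¹ : ℂ) = ((2⁻¹ : ℝ) : ℂ) := by norm_num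
  rw [this, Complex.re_ofReal_mul, Complex.add_re, Complex.ofReal_re]
  ring

theorem phaseState_eq (θ : ℝ) :
    phaseState θ = (2⁻¹ : ℂ) • (Matrix.single 0 0 1 + Matrix.single 1 1 1 +
      Complex.exp (-(Complex.I * θ)) • Matrix.single 0 1 1 +
      Complex.exp (Complex.I * θ) • Matrix.single 1 0 1) := by
  have h2 : (Real.sqrt 2 : ℂ) * Real.sqrt 2 = 2 := by
    rw [← Complex.ofReal_mul, Real.mul_self_sqrt (by norm_num)]; norm_num
  have h2' : (Real.sqrt 2 : ℂ)⁻¹ * (Real.sqrt 2 : ℂ)⁻¹ = 2⁻¹ := by rw [← mul_inv, h2]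
  have hc : star (Complex.exp (Complex.I * θ)) = Complex.exp (-(Complex.I * θ)) := by
    rw [Complex.star_def, ← Complex.exp_conj]; simp
  have hn : Complex.exp (Complex.I * θ) * Complex.exp (-(Complex.I * θ)) = 1 := by
    rw [← Complex.exp_add]; simp
  have h01 : (0 : Bits 1) ≠ 1 := fun h => zero_ne_one (congrFun h 0)
  have hcases (a : Bits 1) : a = 0 ∨ a = 1 := by
    rcases Fin.exists_fin_two.1 ⟨a 0, rfl⟩ with h | h
    · exact .inl (funext fun i => by rw [Subsingleton.elim i 0]; exact h)
    · exact .inr (funext fun i => by rw [Subsingleton.elim i 0]; exact h)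
  have hs : star (Real.sqrt 2 : ℂ) = Real.sqrt 2 := Complex.conj_ofReal _
  ext a b
  rcases hcases a with rfl | rfl <;> rcases hcases b with rfl | rfl <;>
    simp only [phaseState, Matrix.vecMulVec_apply, phaseKet, Pi.star_apply, Pi.zero_apply,
      Pi.one_apply, if_true, one_ne_zero, if_false, div_eq_mul_inv, star_mul', star_inv₀, hs,
      hc, Matrix.smul_apply, Matrix.add_apply, Matrix.single_apply, h01, h01.symm,
      smul_eq_mul, and_true, and_false, mul_one, mul_zero, add_zero, zero_add, one_mul]
  · exact h2'
  · linear_combination Complex.exp (-(Complex.I * θ)) * h2'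
  · linear_combination Complex.exp (Complex.I * θ) * h2'
  · linear_combination 2⁻¹ * hn +
      Complex.exp (Complex.I * θ) * Complex.exp (-(Complex.I * θ)) * h2'

theorem phaseState_posSemidef (θ : ℝ) : (phaseState θ).PosSemidef :=
  Matrix.posSemidef_vecMulVec_self_star _

theorem trace_phaseState (θ : ℝ) : (phaseState θ).trace = 1 := by
  rw [phaseState_eq]
  have h01 : (0 : Bits 1) ≠ 1 := fun h => zero_ne_one (congrFun h 0)
  rw [Matrix.trace_smul, Matrix.trace_add, Matrix.trace_add, Matrix.trace_add, Matrix.trace_smul,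
    Matrix.trace_smul, Matrix.trace_single_eq_same, Matrix.trace_single_eq_same,
    Matrix.trace_single_eq_of_ne _ _ _ h01, Matrix.trace_single_eq_of_ne _ _ _ h01.symm]
  norm_num

/-! ### Bounding the cost by exponential sums -/

/-- The exponential sum `T⁻¹ ∑ e^{-ivt} e^{ikφ_t}`. -/
noncomputable def phaseSum {T : ℕ} (v : ℝ) (k : ℕ) (φ : Fin T → ℝ) : ℂ :=
  (T : ℂ)⁻¹ * ∑ t : Fin T, Complex.exp (-(Complex.I * (v * (t : ℕ)))) *
    Complex.exp (k * Complex.I * φ t)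

/-- The label contributes one factor `e^{iφ}` and the input entries contribute `e^{-iφ}`, `1` or
`e^{iφ}`, so only the frequencies 0, 1, 2 occur. -/
theorem IsCPTP.driftCost_eq {T : ℕ} (hT : 1 ≤ T) {E : Op 1 →ₗ[ℂ] Op 1} (hE : IsCPTP E) (v : ℝ)
    (φ : Fin T → ℝ) :
    driftCost v φ E = 1 / 2 + (2⁻¹ * (E (Matrix.single 0 1 1) 0 1 * phaseSum v 0 φ +
      (E (Matrix.single 0 0 1) 0 1 + E (Matrix.single 1 1 1) 0 1) * phaseSum v 1 φ +
      E (Matrix.single 1 0 1) 0 1 * phaseSum v 2 φ)).re := by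
  have hT0 : (T : ℝ) ≠ 0 := by positivity
  have hfid (t : Fin T) : fidelity (φ t - v * (t : ℕ)) (E (phaseState (φ t))) = 1 / 2 +
      (2⁻¹ * (E (Matrix.single 0 1 1) 0 1 * (Complex.exp (-(Complex.I * (v * (t : ℕ)))) *
        Complex.exp ((0 : ℕ) * Complex.I * φ t)) +
      (E (Matrix.single 0 0 1) 0 1 + E (Matrix.single 1 1 1) 0 1) *
        (Complex.exp (-(Complex.I * (v * (t : ℕ)))) *
        Complex.exp ((1 : ℕ) * Complex.I * φ t)) +
      E (Matrix.single 1 0 1) 0 1 * (Complex.exp (-(Complex.I * (v * (t : ℕ)))) *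
        Complex.exp ((2 : ℕ) * Complex.I * φ t)))).re := by
    rw [fidelity_eq (hE.posSemidef (phaseState_posSemidef _)).1, hE.trace_preserving,
      trace_phaseState, phaseState_eq, Complex.one_re]
    congr 2
    have e0 : Complex.exp (Complex.I * ((φ t - v * (t : ℕ) : ℝ) : ℂ)) =
        Complex.exp (Complex.I * φ t) * Complex.exp (-(Complex.I * (v * (t : ℕ)))) := by
      rw [← Complex.exp_add]; push_cast; ring_nf
    have e1 : Complex.exp (((1 : ℕ) : ℂ) * Complex.I * φ t) = Complex.exp (Complex.I * φ t) := by
      push_cast; ring_nf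
    have e2 : Complex.exp (((2 : ℕ) : ℂ) * Complex.I * φ t) =
        Complex.exp (Complex.I * φ t) * Complex.exp (Complex.I * φ t) := by
      rw [← Complex.exp_add]; push_cast; ring_nf
    have e3 : Complex.exp (((0 : ℕ) : ℂ) * Complex.I * φ t) = 1 := by simp
    have hn : Complex.exp (Complex.I * φ t) * Complex.exp (-(Complex.I * φ t)) = 1 := by
      rw [← Complex.exp_add]; simp
    rw [e0, e1, e2, e3]
    simp only [map_smul, map_add, Matrix.smul_apply, Matrix.add_apply, smul_eq_mul]
    linear_combination 2⁻¹ * E (Matrix.single 0 1 1) 0 1 *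
      Complex.exp (-(Complex.I * (v * (t : ℕ)))) * hn
  rw [driftCost]
  simp_rw [hfid]
  rw [Finset.sum_add_distrib, Finset.sum_const, Finset.card_univ, Fintype.card_fin,
    ← Complex.re_sum, ← Finset.mul_sum, Finset.sum_add_distrib, Finset.sum_add_distrib,
    ← Finset.mul_sum, ← Finset.mul_sum, ← Finset.mul_sum, nsmul_eq_mul, mul_add,
    ← Complex.re_ofReal_mul]
  congr 1
  · field_simp
  · congr 1
    simp only [phaseSum]
    push_cast
    ring

theorem IsCPTP.driftCost_le {T : ℕ} (hT : 1 ≤ T) {E : Op 1 →ₗ[ℂ] Op 1} (hE : IsCPTP E) (v : ℝ)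
    (φ : Fin T → ℝ) :
    driftCost v φ E ≤ 1 / 2 + (‖phaseSum v 0 φ‖ + ‖phaseSum v 1 φ‖ + ‖phaseSum v 2 φ‖) := by
  rw [hE.driftCost_eq hT]
  refine add_le_add le_rfl ((Complex.re_le_norm _).trans ?_)
  have h1 : ‖E (Matrix.single 0 1 1) 0 1 * phaseSum v 0 φ‖ ≤ 1 * ‖phaseSum v 0 φ‖ := by
    rw [norm_mul]; gcongr; exact hE.norm_apply_single_le _ _ _ _
  have h2 : ‖(E (Matrix.single 0 0 1) 0 1 + E (Matrix.single 1 1 1) 0 1) * phaseSum v 1 φ‖ ≤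
      (1 + 1) * ‖phaseSum v 1 φ‖ := by
    rw [norm_mul]; gcongr
    exact norm_add_le_of_le (hE.norm_apply_single_le _ _ _ _) (hE.norm_apply_single_le _ _ _ _)
  have h3 : ‖E (Matrix.single 1 0 1) 0 1 * phaseSum v 2 φ‖ ≤ 1 * ‖phaseSum v 2 φ‖ := by
    rw [norm_mul]; gcongr; exact hE.norm_apply_single_le _ _ _ _
  have h := norm_add_le_of_le (norm_add_le_of_le h1 h2) h3
  rw [norm_mul, norm_inv, Complex.norm_ofNat]
  linarith [norm_nonneg (phaseSum v 0 φ), norm_nonneg (phaseSum v 2 φ)]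

theorem norm_phaseSum_zero_le {T : ℕ} {v : ℝ} (hv : Complex.exp (Complex.I * v) ≠ 1)
    (φ : Fin T → ℝ) :
    ‖phaseSum v 0 φ‖ ≤ 2 / (T * ‖1 - Complex.exp (Complex.I * v)‖) := by
  set z := Complex.exp (-(Complex.I * v)) with hz
  have hz1 : ‖z‖ = 1 := by
    rw [hz, show -(Complex.I * (v : ℂ)) = ((-v : ℝ) : ℂ) * Complex.I by push_cast; ring,
      Complex.norm_exp_ofReal_mul_I]
  have hzw : z * Complex.exp (Complex.I * v) = 1 := by rw [hz, ← Complex.exp_add]; simp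
  -- Since `z` is unimodular and inverse to `e^{iv}`, `z - 1 = z (1 - e^{iv})`.
  have hd : ‖z - 1‖ = ‖1 - Complex.exp (Complex.I * v)‖ := by
    rw [← one_mul ‖1 - _‖, ← hz1, ← norm_mul, mul_sub, hzw, mul_one]
  have hsum : phaseSum v 0 φ = (T : ℂ)⁻¹ * ∑ i ∈ Finset.range T, z ^ i := by
    rw [phaseSum, ← Fin.sum_univ_eq_sum_range]
    congr 1
    refine Finset.sum_congr rfl fun t _ => ?_
    rw [hz, ← Complex.exp_nat_mul]
    simp only [Nat.cast_zero, zero_mul, Complex.exp_zero, mul_one]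
    ring_nf
  have hd0 : 0 < ‖1 - Complex.exp (Complex.I * v)‖ := norm_pos_iff.2 (sub_ne_zero.2 hv.symm)
  have hg : ‖∑ i ∈ Finset.range T, z ^ i‖ ≤ 2 / ‖1 - Complex.exp (Complex.I * v)‖ := by
    rw [le_div_iff₀ hd0, ← hd, ← norm_mul, geom_sum_mul]
    refine (norm_sub_le _ _).trans ?_
    rw [norm_pow, hz1]
    norm_num
  rw [hsum, norm_mul, norm_inv, Complex.norm_natCast, div_mul_eq_div_div_swap, div_eq_inv_mul _ (T : ℝ)]
  gcongr

open MeasureTheory ProbabilityTheory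

/-! ### Second moments of the exponential sums -/

theorem integral_exp_of_isUniform {Ω : Type*} [MeasurableSpace Ω] {P : Measure Ω} {X : Ω → ℝ}
    (hX : Measurable X) (hU : pdf.IsUniform X (Set.Ico 0 (2 * Real.pi)) P) {k : ℕ} (hk : k ≠ 0) :
    ∫ ω, Complex.exp (k * Complex.I * X ω) ∂P = 0 := by
  have hk' : (k : ℂ) * Complex.I ≠ 0 := by simp [hk]
  have hc : Continuous fun x : ℝ => Complex.exp (k * Complex.I * x) := by fun_prop
  rw [← integral_map (f := fun x : ℝ => Complex.exp (k * Complex.I * x)) hX.aemeasurable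
    hc.aestronglyMeasurable, hU, ProbabilityTheory.cond, integral_smul_measure,
    integral_Ico_eq_integral_Ioc, ← intervalIntegral.integral_of_le Real.two_pi_pos.le,
    integral_exp_mul_complex hk']
  rw [show (k : ℂ) * Complex.I * ((2 * Real.pi : ℝ) : ℂ) = k * (2 * Real.pi * Complex.I) by
    push_cast; ring, Complex.exp_nat_mul_two_pi_mul_I]
  simp

/-- Independence and zero mean make the `X i` orthonormal in `L²`, so only the diagonal terms of the
expanded square survive. -/
theorem integral_norm_sq_sum_eq {Ω ι : Type*} [Fintype ι] [MeasurableSpace Ω] {P : Measure Ω}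
    [IsProbabilityMeasure P] {X : ι → Ω → ℂ} (hX : ∀ i, Measurable (X i)) (hI : iIndepFun X P)
    (hm : ∀ i, ∫ ω, X i ω ∂P = 0) (hn : ∀ i ω, ‖X i ω‖ = 1) :
    ∫ ω, ‖∑ i, X i ω‖ ^ 2 ∂P = Fintype.card ι := by
  classical
  have hstar (j : ι) : Measurable fun ω => star (X j ω) :=
    (continuous_star (R := ℂ)).measurable.comp (hX j)
  have hint (i j : ι) : Integrable (fun ω => X i ω * star (X j ω)) P :=
    .of_bound ((hX i).mul (hstar j)).aestronglyMeasurable 1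
      (.of_forall fun ω => by rw [norm_mul, norm_star, hn, hn, one_mul])
  have hij (i j : ι) : ∫ ω, X i ω * star (X j ω) ∂P = if i = j then 1 else 0 := by
    split_ifs with h
    · subst h
      have (ω : Ω) : X i ω * star (X i ω) = 1 := by
        rw [Complex.star_def, Complex.mul_conj, Complex.normSq_eq_norm_sq, hn]; simp
      simp_rw [this]
      simp
    · have hind : IndepFun (X i) (fun ω => star (X j ω)) P :=
        (hI.indepFun h).comp measurable_id (continuous_star (R := ℂ)).measurable
      rw [hind.integral_fun_mul_eq_mul_integral (hX i).aestronglyMeasurable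
        (hstar j).aestronglyMeasurable, hm, zero_mul]
  have key : ((∫ ω, ‖∑ i, X i ω‖ ^ 2 ∂P : ℝ) : ℂ) = Fintype.card ι := by
    rw [← integral_complex_ofReal]
    have (ω : Ω) : ((‖∑ i, X i ω‖ ^ 2 : ℝ) : ℂ) = ∑ i, ∑ j, X i ω * star (X j ω) := by
      rw [← Complex.normSq_eq_norm_sq, ← Complex.mul_conj, ← Complex.star_def, star_sum,
        Finset.sum_mul_sum]
    simp_rw [this]
    rw [integral_finsetSum _ fun i _ => integrable_finsetSum _ fun j _ => hint i j]
    simp_rw [integral_finsetSum _ fun j _ => hint _ j, hij]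
    simp
  exact_mod_cast key

section

variable {Ω : Type*} [MeasurableSpace Ω] {P : Measure Ω} {T : ℕ} {φ : Fin T → Ω → ℝ}

theorem measurable_phaseSum (hφ : ∀ t, Measurable (φ t)) (v : ℝ) (k : ℕ) :
    Measurable fun ω => phaseSum v k fun t => φ t ω := by
  unfold phaseSum
  fun_prop

theorem norm_exp_mul_exp (x : ℝ) (v : ℝ) (k t : ℕ) :
    ‖Complex.exp (-(Complex.I * (v * t))) * Complex.exp (k * Complex.I * x)‖ = 1 := by
  rw [← Complex.exp_add, show -(Complex.I * ((v : ℂ) * t)) + k * Complex.I * x =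
    ((-(v * t) + k * x : ℝ) : ℂ) * Complex.I by push_cast; ring, Complex.norm_exp_ofReal_mul_I]

theorem norm_phaseSum_le_one (v : ℝ) (k : ℕ) (x : Fin T → ℝ) : ‖phaseSum v k x‖ ≤ 1 := by
  rw [phaseSum, norm_mul, norm_inv, Complex.norm_natCast]
  have h : ‖∑ t : Fin T, Complex.exp (-(Complex.I * (v * (t : ℕ)))) *
      Complex.exp (k * Complex.I * x t)‖ ≤ T := by
    refine (norm_sum_le _ _).trans ?_
    simp only [norm_exp_mul_exp]
    simp
  exact inv_mul_le_one_of_le₀ h (Nat.cast_nonneg T)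

theorem integrable_norm_phaseSum_sq [IsProbabilityMeasure P] (hφ : ∀ t, Measurable (φ t)) (v : ℝ)
    (k : ℕ) : Integrable (fun ω => ‖phaseSum v k fun t => φ t ω‖ ^ 2) P :=
  .of_bound ((measurable_phaseSum hφ v k).norm.pow_const 2).aestronglyMeasurable 1
    (.of_forall fun ω => by
      rw [norm_pow, norm_norm]
      exact pow_le_one₀ (norm_nonneg _) (norm_phaseSum_le_one _ _ _))

theorem integral_norm_phaseSum_sq [IsProbabilityMeasure P] (hφ : ∀ t, Measurable (φ t))
    (hI : iIndepFun φ P) (hU : ∀ t, pdf.IsUniform (φ t) (Set.Ico 0 (2 * Real.pi)) P)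
    (v : ℝ) {k : ℕ} (hk : k ≠ 0) :
    ∫ ω, ‖phaseSum v k fun t => φ t ω‖ ^ 2 ∂P = (T : ℝ)⁻¹ := by
  have hf (t : Fin T) : Measurable fun x : ℝ =>
      Complex.exp (-(Complex.I * (v * (t : ℕ)))) * Complex.exp (k * Complex.I * x) := by
    fun_prop
  have h := integral_norm_sq_sum_eq (P := P)
    (X := fun (t : Fin T) ω => Complex.exp (-(Complex.I * (v * (t : ℕ)))) *
      Complex.exp (k * Complex.I * φ t ω)) (fun t => (hf t).comp (hφ t)) (hI.comp _ hf)
    (fun t => by rw [integral_const_mul, integral_exp_of_isUniform (hφ t) (hU t) hk, mul_zero])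
    (fun t ω => norm_exp_mul_exp _ _ _ _)
  simp only [phaseSum, norm_mul _ (Finset.sum _ _), mul_pow, norm_inv, Complex.norm_natCast]
  rw [integral_const_mul, h, Fintype.card_fin]
  rcases eq_or_ne (T : ℝ) 0 with h0 | h0
  · simp [h0]
  · field_simp

/-- Chebyshev's inequality for the two random exponential sums. -/
theorem one_sub_le_measureReal_phaseSum [IsProbabilityMeasure P] (hT : 1 ≤ T)
    (hφ : ∀ t, Measurable (φ t)) (hI : iIndepFun φ P)
    (hU : ∀ t, pdf.IsUniform (φ t) (Set.Ico 0 (2 * Real.pi)) P) (v : ℝ) {η : ℝ} (hη : 0 < η) :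
    1 - η ≤ P.real {ω | (‖phaseSum v 1 fun t => φ t ω‖ + ‖phaseSum v 2 fun t => φ t ω‖) ≤
      2 / Real.sqrt (η * T)} := by
  have hT0 : (0 : ℝ) < T := by positivity
  -- Adding the two squares lets a single application of Markov's inequality handle both sums: the
  -- mean is `2/T`, so the threshold `2/(ηT)` is reached with probability at most `η`.
  let Z : Ω → ℝ := fun ω =>
    ‖phaseSum v 1 fun t => φ t ω‖ ^ 2 + ‖phaseSum v 2 fun t => φ t ω‖ ^ 2
  have hi1 := integrable_norm_phaseSum_sq (P := P) hφ v 1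
  have hi2 := integrable_norm_phaseSum_sq (P := P) hφ v 2
  have hZ : ∫ ω, Z ω ∂P = 2 / T := by
    rw [integral_add hi1 hi2, integral_norm_phaseSum_sq hφ hI hU v one_ne_zero,
      integral_norm_phaseSum_sq hφ hI hU v two_ne_zero]
    ring
  have hZm : Measurable Z := ((measurable_phaseSum hφ v 1).norm.pow_const 2).add
    ((measurable_phaseSum hφ v 2).norm.pow_const 2)
  have hM := mul_meas_ge_le_integral_of_nonneg (μ := P) (f := Z)
    (.of_forall fun ω => by positivity) (hi1.add hi2) (2 / (η * T))
  have hbad : P.real {ω | 2 / (η * T) ≤ Z ω} ≤ η := by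
    rw [hZ, div_mul_eq_mul_div, div_le_div_iff₀ (by positivity) hT0] at hM
    have : 2 * T * P.real {ω | 2 / (η * T) ≤ Z ω} ≤ 2 * T * η := by linarith
    exact le_of_mul_le_mul_left this (by positivity)
  have hcompl := probReal_compl_eq_one_sub (μ := P)
    (measurableSet_le (measurable_const (a := 2 / (η * T))) hZm)
  have hsub : {ω | 2 / (η * T) ≤ Z ω}ᶜ ⊆
      {ω | (‖phaseSum v 1 fun t => φ t ω‖ + ‖phaseSum v 2 fun t => φ t ω‖) ≤
        2 / Real.sqrt (η * T)} := by
    intro ω hω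
    have hlt : Z ω < 2 / (η * T) := lt_of_not_ge hω
    rw [Set.mem_ofPred_eq]
    refine (pow_le_pow_iff_left₀ (by positivity) (by positivity) two_ne_zero).1 ?_
    rw [div_pow, Real.sq_sqrt (by positivity)]
    have : (2 : ℝ) ^ 2 / (η * T) = 2 * (2 / (η * T)) := by ring
    rw [this]
    -- `(a + b)² ≤ 2(a² + b²)` turns the bound on `Z` into one on the sum of norms.
    exact (add_sq_le).trans (by gcongr)
  linarith [measureReal_mono hsub (μ := P)]

end

/-! ### Assembling the bounds -/

/-- The constant is `6 = 2 + 4`: the geometric term uses `T^{1/3} ≤ T` and `√η ≤ 1`, while the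
random term uses `T^{1/3} ≤ √T` and pays a factor 2 to acquire `d ≤ 2` in its denominator. -/
theorem upper_bound_arith {T : ℕ} (hT : 1 ≤ T) {η d : ℝ} (hη : 0 < η) (hη1 : η ≤ 1) (hd : 0 < d)
    (hd2 : d ≤ 2) :
    2 / (T * d) + 2 / Real.sqrt (η * T) ≤
      6 / (Real.sqrt η * d) * (1 / (T : ℝ) ^ ((1 : ℝ) / 3)) := by
  have hT1 : (1 : ℝ) ≤ T := by exact_mod_cast hT
  have hT0 : (0 : ℝ) < T := by positivity
  have hs : 0 < Real.sqrt η := Real.sqrt_pos.2 hη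
  have hs1 : Real.sqrt η ≤ 1 := Real.sqrt_le_one.2 hη1
  have hr : 0 < (T : ℝ) ^ ((1 : ℝ) / 3) := Real.rpow_pos_of_pos hT0 _
  have hr1 : (T : ℝ) ^ ((1 : ℝ) / 3) ≤ T := by
    conv_rhs => rw [← Real.rpow_one (T : ℝ)]
    exact Real.rpow_le_rpow_of_exponent_le hT1 (by norm_num)
  have hr2 : (T : ℝ) ^ ((1 : ℝ) / 3) ≤ Real.sqrt T := by
    rw [Real.sqrt_eq_rpow]
    exact Real.rpow_le_rpow_of_exponent_le hT1 (by norm_num)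
  set r := (T : ℝ) ^ ((1 : ℝ) / 3)
  have h1 : 2 / (T * d) ≤ 2 / (r * (Real.sqrt η * d)) := by
    gcongr
    calc Real.sqrt η * d ≤ 1 * d := by gcongr
      _ = d := one_mul d
  have h2 : 2 / Real.sqrt (η * T) ≤ 4 / (r * (Real.sqrt η * d)) := by
    rw [Real.sqrt_mul hη.le, div_le_div_iff₀ (by positivity) (by positivity)]
    calc 2 * (r * (Real.sqrt η * d)) ≤ 2 * (Real.sqrt T * (Real.sqrt η * 2)) := by gcongr
      _ = 4 * (Real.sqrt η * Real.sqrt T) := by ring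
  calc _ ≤ _ := add_le_add h1 h2
    _ = _ := by field_simp; norm_num

section

variable {T : ℕ} (v : ℝ) (φ : Fin T → ℝ)

/-- Needed because a real supremum over an unbounded family takes a default value. -/
theorem bddAbove_range_driftCost (hT : 1 ≤ T) :
    BddAbove (Set.range fun E : {E : Op 1 →ₗ[ℂ] Op 1 // IsCPTP E} => driftCost v φ E.1) :=
  ⟨_, Set.forall_mem_range.2 fun E => E.2.driftCost_le hT v φ⟩

theorem driftCost_channel_le_channelOptimalCost (hT : 1 ≤ T) (A : Arch 1 1) (U : A.Params) :
    driftCost v φ (A.channel U) ≤ channelOptimalCost v φ := by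
  obtain ⟨E, hE, hEU⟩ := A.exists_isCPTP U
  rw [← hEU]
  exact le_ciSup (bddAbove_range_driftCost v φ hT) ⟨E, hE⟩

theorem qnnOptimalCost_le_channelOptimalCost (hT : 1 ≤ T) (A : Arch 1 1) :
    qnnOptimalCost v φ A ≤ channelOptimalCost v φ :=
  have : Nonempty A.Params := ⟨A.exists_channel_eq_zeroState.choose⟩
  ciSup_le fun U => driftCost_channel_le_channelOptimalCost v φ hT A U

theorem fidelity_zeroState (θ : ℝ) : fidelity θ (zeroState 1) = 1 / 2 := by
  have h01 : (0 : Bits 1) ≠ 1 := fun h => zero_ne_one (congrFun h 0)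
  rw [fidelity_eq (by simp [Matrix.IsHermitian, zeroState]), zeroState,
    Matrix.trace_single_eq_same, Matrix.single_apply_of_col_ne _ _ h01]
  simp

theorem half_le_qnnOptimalCost (hT : 1 ≤ T) (A : Arch 1 1) : 1 / 2 ≤ qnnOptimalCost v φ A := by
  obtain ⟨U, hU⟩ := A.exists_channel_eq_zeroState
  have hcost : driftCost v φ (A.channel U) = 1 / 2 := by
    have hT0 : (T : ℝ) ≠ 0 := by positivity
    simp only [driftCost, hU, trace_phaseState, one_smul, fidelity_zeroState, Finset.sum_const,
      Finset.card_univ, Fintype.card_fin, nsmul_eq_mul]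
    field_simp
  rw [← hcost]
  exact le_ciSup (f := fun U => driftCost v φ (A.channel U))
    ⟨_, Set.forall_mem_range.2 fun U => driftCost_channel_le_channelOptimalCost v φ hT A U⟩ U

theorem half_le_channelOptimalCost (hT : 1 ≤ T) : 1 / 2 ≤ channelOptimalCost v φ :=
  (half_le_qnnOptimalCost v φ hT (.single fun _ => ∅)).trans
    (qnnOptimalCost_le_channelOptimalCost v φ hT _)

variable {v}

theorem channelOptimalCost_le (hT : 1 ≤ T) (hv : Complex.exp (Complex.I * v) ≠ 1) {η : ℝ}
    (hη : 0 < η) (hη1 : η ≤ 1)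
    (hφ : ‖phaseSum v 1 φ‖ + ‖phaseSum v 2 φ‖ ≤ 2 / Real.sqrt (η * T)) :
    channelOptimalCost v φ ≤ 1 / 2 + 6 / (Real.sqrt η * ‖1 - Complex.exp (Complex.I * v)‖) *
      (1 / (T : ℝ) ^ ((1 : ℝ) / 3)) := by
  obtain ⟨E₀, hE₀, -⟩ := Arch.exists_isCPTP (.single fun _ => ∅ : Arch 1 1)
    (Arch.exists_channel_eq_zeroState _).choose
  have : Nonempty {E : Op 1 →ₗ[ℂ] Op 1 // IsCPTP E} := ⟨⟨E₀, hE₀⟩⟩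
  have hd2 : ‖1 - Complex.exp (Complex.I * v)‖ ≤ 2 := by
    refine (norm_sub_le _ _).trans ?_
    rw [mul_comm, Complex.norm_exp_ofReal_mul_I]
    norm_num
  have h := upper_bound_arith hT hη hη1 (norm_pos_iff.2 (sub_ne_zero.2 hv.symm)) hd2
  refine ciSup_le fun E => (E.2.driftCost_le hT v φ).trans ?_
  linarith [norm_phaseSum_zero_le hv φ]

end

end DriftQNN

theorem mainTheorem2 :
    ∃ c : ℝ, 0 < c ∧
      ∀ v : ℝ, Complex.exp (Complex.I * v) ≠ 1 →
      ∀ T : ℕ, 1 ≤ T →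
      ∀ {Ω : Type*} [MeasurableSpace Ω] (P : MeasureTheory.Measure Ω)
        [MeasureTheory.IsProbabilityMeasure P] (φ : Fin T → Ω → ℝ),
        (∀ t, Measurable (φ t)) →
        ProbabilityTheory.iIndepFun φ P →
        (∀ t, MeasureTheory.pdf.IsUniform (φ t) (Set.Ico 0 (2 * Real.pi)) P) →
        (∀ η : ℝ, 0 < η →
          1 - η ≤ P.real {ω |
            DriftQNN.channelOptimalCost v (fun t => φ t ω) ≤
                1 / 2 + c / (Real.sqrt η * ‖1 - Complex.exp (Complex.I * v)‖) *
                  (1 / (T : ℝ) ^ ((1 : ℝ) / 3)) ∧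
            ∀ A : DriftQNN.Arch 1 1,
              DriftQNN.qnnOptimalCost v (fun t => φ t ω) A ≤
                1 / 2 + c / (Real.sqrt η * ‖1 - Complex.exp (Complex.I * v)‖) *
                  (1 / (T : ℝ) ^ ((1 : ℝ) / 3))}) ∧
        ∀ ω : Ω,
          1 / 2 ≤ DriftQNN.channelOptimalCost v (fun t => φ t ω) ∧
          ∀ A : DriftQNN.Arch 1 1, 1 / 2 ≤ DriftQNN.qnnOptimalCost v (fun t => φ t ω) A := by
  refine ⟨6, by norm_num, fun v hv T hT Ω _ P _ φ hφ hI hU => ⟨fun η hη => ?_, fun ω =>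
    ⟨DriftQNN.half_le_channelOptimalCost v _ hT,
      fun A => DriftQNN.half_le_qnnOptimalCost v _ hT A⟩⟩⟩
  -- For `η ≥ 1` the probability bound is void; the arithmetic estimate needs `η ≤ 1`.
  rcases le_total 1 η with h1 | h1
  · exact (sub_nonpos.2 h1).trans MeasureTheory.measureReal_nonneg
  -- Monotonicity of the measure needs only inclusion, so measurability of the event defined by
  -- suprema never has to be shown.
  · refine (DriftQNN.one_sub_le_measureReal_phaseSum hT hφ hI hU v hη).trans
      (MeasureTheory.measureReal_mono fun ω hω => ?_)
    have h := DriftQNN.channelOptimalCost_le (fun t => φ t ω) hT hv hη h1 hω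
    exact ⟨h, fun A => (DriftQNN.qnnOptimalCost_le_channelOptimalCost v _ hT A).trans h⟩
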